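/- Let $n\ge 1$. A configuration is a perfect matching of the $2n$ points $1,\dots,2n$ on a line into $n$ pairs, together with one marked pair (the given pair); there are $n\,(2n-1)!!$ configurations, taken to be equally likely. Another pair is excluded by the given pair $\{a<b\}$ if both of its endpoints are less than $a$ or both are greater than $b$. Let $X_{n,p}$ be the number of configurations in which exactly $p$ pairs are excluded by the given pair, and let $\mathcal X_n(p)=X_{n,p}/\bigl(n\,(2n-1)!!\bigr)$ be the corresponding probability. Define, for $x\in[0,1]$, $$\mathcal X(x)=\begin{cases}\pi/2, & 0\le x<1/2,\\ \pi/2-2\tan^{-1}\sqrt{2x-1}, & 1/2\le x\le 1.\end{cases}$$ Then $\mathcal X$ is the asymptotic distribution of the number of excluded pairs, that is: 1. for every $x\in[0,1]$ and every sequence of integers $p_n\ge 0$ with $p_n/(n-1)\to x$, $$\lim_{n\to\infty}(n-1)\,\mathcal X_n(p_n)=\mathcal X(x);$$ 2. for every $x\in[0,1]$, $$\lim_{n\to\infty}\ \sum_{0\le p\le (n-1)x}\mathcal X_n(p)=\int_0^x\mathcal X(t)\,dt .$$ In particular, the probability that fewer than half of the $n-1$ other pairs are excluded, $\sum_{0\le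 p<(n-1)/2}\mathcal X_n(p)$, tends to $\pi/4$ as $n\to\infty$. -/

import Mathlib

/-- A linear chord diagram on the `2 * n` vertices `0 < 1 < ⋯ < 2 * n - 1`: a perfect matching of
the vertices, given as the fixed-point-free involution that sends each vertex to its partner. -/
def IsChordDiagram {n : ℕ} (σ : Equiv.Perm (Fin (2 * n))) : Prop :=
  ∀ i, σ (σ i) = i ∧ σ i ≠ i

instance {n : ℕ} (σ : Equiv.Perm (Fin (2 * n))) : Decidable (IsChordDiagram σ) :=
  inferInstanceAs (Decidable (∀ i, σ (σ i) = i ∧ σ i ≠ i))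

/-- The left endpoints of the chords; they index the pairs `{i, σ i}` of the diagram. -/
def leftEndpoints {n : ℕ} (σ : Equiv.Perm (Fin (2 * n))) : Finset (Fin (2 * n)) :=
  Finset.univ.filter fun i => i < σ i

/-- Configurations of `n` pairs with one given (marked) pair: a chord diagram together with the
left endpoint of the marked chord. -/
def configurations (n : ℕ) : Finset (Equiv.Perm (Fin (2 * n)) × Fin (2 * n)) :=
  Finset.univ.filter fun c => IsChordDiagram c.1 ∧ c.2 ∈ leftEndpoints c.1

/-- The pairs (indexed by left endpoints `j`) excluded by the pair `{i, σ i}`, where `i < σ i`: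
both endpoints are to the left of `i`, or both are to the right of `σ i`. -/
def excludedPairs {n : ℕ} (σ : Equiv.Perm (Fin (2 * n))) (i : Fin (2 * n)) :
    Finset (Fin (2 * n)) :=
  (leftEndpoints σ).filter fun j => (j < i ∧ σ j < i) ∨ (σ i < j ∧ σ i < σ j)

/-- `X_{n,p}`: the number of configurations in which exactly `p` pairs are excluded by the
given pair. -/
def excludedCount (n p : ℕ) : ℕ :=
  ((configurations n).filter fun c => (excludedPairs c.1 c.2).card = p).card

/-- `𝒳_n(p) = X_{n,p} / (n (2n-1)!!)`: the probability that exactly `p` pairs are excluded, all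
`n (2n-1)!!` configurations being equally likely (`n ≥ 1`). -/
noncomputable def excludedProb (n p : ℕ) : ℝ :=
  (excludedCount n p : ℝ) / ((n : ℝ) * (Nat.doubleFactorial (2 * n - 1) : ℝ))

/-- The limiting density `𝒳(x)`, for `x ∈ [0, 1]`. -/
noncomputable def excludedDensity (x : ℝ) : ℝ :=
  if x < 1 / 2 then Real.pi / 2 else Real.pi / 2 - 2 * Real.arctan (Real.sqrt (2 * x - 1))

/-! Place the `2 * n` labels at independent uniform positions in `[0, 1]`. Their order is a
uniformly random permutation, and conjugating any fixed diagram with a marked vertex by it yields a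
uniformly random configuration (`excludedProb_eq_of_card_perm`, `card_perm_eq_factorial_mul`).

If the marked pair sits at `a`, each of the other `n - 1` pairs is excluded independently with
probability `w = min ^ 2 + (1 - max) ^ 2` (`measure_card_exclusionSet`). The point `(min, 1 - max)`
is uniform on a right triangle and `w` is its squared distance `r ^ 2` from the corner. In polar
coordinates `2 r dr = dw`, so the density of `w` is the angle of directions staying in the triangle
at distance `r`, which is `excludedDensity w` (`volume_simplex_angles`). The limiting density is
thus already the exact mixing density at finite `n`: `excludedProb_eq_integral`.

The limits follow from two concentration statements. For fixed `p`, `(m + 1) * binomialMass m p` is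
a beta density in `t`, concentrating at the limit of `p / m`; this gives the local limit. For fixed
`t`, the binomial law concentrates at `p ≈ m * t` by Chebyshev; this with dominated convergence
gives the distribution functions. The value `π / 4` arises because the density is constantly `π / 2`
up to `1 / 2`. -/

/-! ### Reduction to random orderings of a fixed diagram -/

/-- The labels `k` such that the pair `{k, σ k}` lies entirely below or entirely above the pair
`{i, σ i}` when the labels are ordered by their positions `x`. -/
def exclusionSet {n : ℕ} {α : Type*} [LinearOrder α] (σ : Equiv.Perm (Fin (2 * n)))
    (i : Fin (2 * n)) (x : Fin (2 * n) → α) : Finset (Fin (2 * n)) :=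
  Finset.univ.filter fun k =>
    ((x k < x i ∧ x k < x (σ i)) ∧ (x (σ k) < x i ∧ x (σ k) < x (σ i))) ∨
    ((x i < x k ∧ x (σ i) < x k) ∧ (x i < x (σ k) ∧ x (σ i) < x (σ k)))

/-- The involution `σ` preserves `s` and exchanges its left endpoints with its right endpoints. -/
theorem IsChordDiagram.card_eq_two_mul {n : ℕ} {σ : Equiv.Perm (Fin (2 * n))}
    (h : IsChordDiagram σ) {s : Finset (Fin (2 * n))} (hs : ∀ k ∈ s, σ k ∈ s) :
    s.card = 2 * (s.filter fun k => k < σ k).card := by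
  have h1 := Finset.card_filter_add_card_filter_not (s := s) (fun k => k < σ k)
  have h2 : (s.filter fun k => k < σ k).card = (s.filter fun k => ¬ k < σ k).card := by
    refine Finset.card_bij' (fun k _ => σ k) (fun k _ => σ k) ?_ ?_ ?_ ?_
    · intro k hk
      simp only [Finset.mem_filter] at hk ⊢
      exact ⟨hs k hk.1, by rw [(h k).1]; exact not_lt.2 hk.2.le⟩
    · intro k hk
      simp only [Finset.mem_filter] at hk ⊢
      exact ⟨hs k hk.1, by rw [(h k).1]; exact lt_of_le_of_ne (not_lt.1 hk.2) (h k).2⟩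
    · intro k _; exact (h k).1
    · intro k _; exact (h k).1
  omega

theorem IsChordDiagram.map_mem_exclusionSet {n : ℕ} {α : Type*} [LinearOrder α]
    {σ : Equiv.Perm (Fin (2 * n))} (h : IsChordDiagram σ) (i : Fin (2 * n))
    (x : Fin (2 * n) → α) : ∀ k ∈ exclusionSet σ i x, σ k ∈ exclusionSet σ i x := by
  intro k hk
  simp only [exclusionSet, Finset.mem_filter, Finset.mem_univ, true_and, (h k).1] at hk ⊢
  tauto

theorem exclusionSet_partner {n : ℕ} {α : Type*} [LinearOrder α]
    {σ : Equiv.Perm (Fin (2 * n))} (h : IsChordDiagram σ) (i : Fin (2 * n))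
    (x : Fin (2 * n) → α) : exclusionSet σ (σ i) x = exclusionSet σ i x := by
  ext k
  simp only [exclusionSet, Finset.mem_filter, Finset.mem_univ, true_and, (h i).1]
  tauto

theorem excludedPairs_eq_filter_exclusionSet {n : ℕ} {σ : Equiv.Perm (Fin (2 * n))}
    {i : Fin (2 * n)} (hi : i < σ i) :
    excludedPairs σ i = (exclusionSet σ i id).filter fun k => k < σ k := by
  ext k
  simp only [excludedPairs, leftEndpoints, exclusionSet, Finset.mem_filter, Finset.mem_univ,
    true_and, id]
  have h1 : k < i → k < σ i := fun h => h.trans hi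
  have h2 : σ k < i → σ k < σ i := fun h => h.trans hi
  have h3 : σ i < k → i < k := fun h => hi.trans h
  have h4 : σ i < σ k → i < σ k := fun h => hi.trans h
  tauto

/-- Diagrams with an arbitrary marked vertex for which `p` pairs are excluded. -/
def markedVertexConfigs (n p : ℕ) : Finset (Equiv.Perm (Fin (2 * n)) × Fin (2 * n)) :=
  Finset.univ.filter fun c => IsChordDiagram c.1 ∧ (exclusionSet c.1 c.2 id).card = 2 * p

/-- Either endpoint of the marked pair may serve as the marked vertex, hence the factor 2. Unlike
left endpoints, vertices are permuted freely by relabelling, which the conjugation argument needs.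
-/
theorem card_markedVertexConfigs (n p : ℕ) :
    (markedVertexConfigs n p).card = 2 * excludedCount n p := by
  have key : ∀ P : Equiv.Perm (Fin (2 * n)) × Fin (2 * n) → Prop, ∀ [DecidablePred P],
      (Finset.univ.filter P).card =
        ∑ σ, (Finset.univ.filter fun i => P (σ, i)).card := by
    intro P _
    simp only [Finset.card_filter, Fintype.sum_prod_type]
  rw [markedVertexConfigs, excludedCount, configurations, Finset.filter_filter, key, key,
    Finset.mul_sum]
  refine Finset.sum_congr rfl fun σ _ => ?_
  by_cases h : IsChordDiagram σ
  · rw [h.card_eq_two_mul, Finset.filter_filter]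
    · congr 2
      ext i
      simp only [Finset.mem_filter, Finset.mem_univ, true_and, leftEndpoints, h]
      by_cases hi : i < σ i
      · rw [excludedPairs_eq_filter_exclusionSet hi,
          h.card_eq_two_mul (h.map_mem_exclusionSet i id)]
        simp [hi]
      · simp [hi]
    · intro k hk
      simpa [exclusionSet_partner h] using hk
  · simp [h]

theorem isChordDiagram_conj {n : ℕ} (g σ : Equiv.Perm (Fin (2 * n))) :
    IsChordDiagram (g * σ * g⁻¹) ↔ IsChordDiagram σ := by
  constructor
  · intro h k
    have := h (g k)
    simpa [Equiv.Perm.mul_apply] using this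
  · intro h k
    refine ⟨by simp [Equiv.Perm.mul_apply, (h _).1], fun hk => (h (g⁻¹ k)).2 ?_⟩
    apply g.injective
    simpa [Equiv.Perm.mul_apply] using hk

theorem card_exclusionSet_conj {n : ℕ} (g σ : Equiv.Perm (Fin (2 * n))) (i : Fin (2 * n)) :
    (exclusionSet (g * σ * g⁻¹) (g i) id).card = (exclusionSet σ i g).card := by
  have : exclusionSet (g * σ * g⁻¹) (g i) id = (exclusionSet σ i g).map g.toEmbedding := by
    ext k
    obtain ⟨k, rfl⟩ := g.surjective k
    simp [exclusionSet, Equiv.Perm.mul_apply]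
  rw [this, Finset.card_map]

/-- Double counting of triples `(g, σ, i)`: for fixed `g`, the map `(σ, i) ↦ (g * σ * g⁻¹, g i)` is
a bijection that turns the order by `g` into the usual order. -/
theorem sum_card_perm_exclusionSet (n p : ℕ) :
    ∑ c : Equiv.Perm (Fin (2 * n)) × Fin (2 * n) with IsChordDiagram c.1,
        (Finset.univ.filter fun g : Equiv.Perm (Fin (2 * n)) =>
          (exclusionSet c.1 c.2 g).card = 2 * p).card =
      (2 * n).factorial * (2 * excludedCount n p) := by
  have h : ∀ g : Equiv.Perm (Fin (2 * n)),
      (Finset.univ.filter fun c : Equiv.Perm (Fin (2 * n)) × Fin (2 * n) =>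
        IsChordDiagram c.1 ∧ (exclusionSet c.1 c.2 g).card = 2 * p).card =
      2 * excludedCount n p := by
    intro g
    rw [← card_markedVertexConfigs, markedVertexConfigs]
    refine Finset.card_equiv ((MulAut.conj g).toEquiv.prodCongr g) fun c => ?_
    simp [isChordDiagram_conj, card_exclusionSet_conj]
  have h' := Finset.sum_congr (rfl : (Finset.univ : Finset (Equiv.Perm (Fin (2 * n)))) = _)
    fun g _ => h g
  rw [Finset.sum_const, Finset.card_univ, Fintype.card_perm, Fintype.card_fin, smul_eq_mul] at h'
  rw [← h']
  simp only [Finset.card_filter, Finset.sum_filter]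
  rw [Finset.sum_comm]
  refine Finset.sum_congr rfl fun c _ => ?_
  by_cases hc : IsChordDiagram c.1 <;> simp [hc]

theorem isChordDiagram_iff_cycleType {n : ℕ} (σ : Equiv.Perm (Fin (2 * n))) :
    IsChordDiagram σ ↔ σ.cycleType = Multiset.replicate n 2 := by
  constructor
  · intro h
    have h2 : σ ^ 2 = 1 := by
      ext k; simp [pow_two, Equiv.Perm.mul_apply, (h k).1]
    have h3 := Equiv.Perm.cycleType_of_pow_prime_eq_one h2
    have h4 := σ.sum_cycleType
    have h5 : σ.support = Finset.univ := by
      ext k; simp [(h k).2]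
    rw [h5, h3, Multiset.sum_replicate, Finset.card_univ, Fintype.card_fin] at h4
    rw [h3]
    congr 1
    simp at h4; omega
  · intro h k
    have h2 : σ ^ 2 = 1 := by
      rw [Equiv.Perm.pow_prime_eq_one_iff]
      intro c hc
      rw [h] at hc
      exact Multiset.eq_of_mem_replicate hc
    have h4 := σ.sum_cycleType
    rw [h, Multiset.sum_replicate] at h4
    have h5 : σ.support = Finset.univ := by
      rw [← Finset.card_eq_iff_eq_univ, Fintype.card_fin, ← h4]; simp [mul_comm]
    refine ⟨by simpa [pow_two] using congrArg (fun f : Equiv.Perm _ => f k) h2, ?_⟩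
    rw [← Equiv.Perm.mem_support, h5]; simp

/-- The class of cycle type `2 ^ n` has `(2n)! / (2 ^ n * n!)` elements, and `(2n)! = (2n-1)!! *
(2n)!!`. -/
theorem card_isChordDiagram {n : ℕ} (hn : 1 ≤ n) :
    (Finset.univ.filter fun σ : Equiv.Perm (Fin (2 * n)) => IsChordDiagram σ).card =
      Nat.doubleFactorial (2 * n - 1) := by
  have h := Equiv.Perm.card_of_cycleType_mul_eq (α := Fin (2 * n)) (Multiset.replicate n 2)
  have h2 : ((Multiset.replicate n 2).sum ≤ Fintype.card (Fin (2 * n)) ∧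
      ∀ a ∈ Multiset.replicate n 2, 2 ≤ a) := by
    refine ⟨by simp [mul_comm], fun a ha => (Multiset.eq_of_mem_replicate ha).ge⟩
  rw [if_pos h2] at h
  simp only [isChordDiagram_iff_cycleType]
  have h3 : (Multiset.replicate n 2).toFinset = {2} := by
    rw [Multiset.toFinset_replicate, if_neg (by omega)]
  rw [h3] at h
  simp only [Multiset.sum_replicate, Fintype.card_fin, Multiset.prod_replicate,
    Finset.prod_singleton, Multiset.count_replicate_self, smul_eq_mul, mul_comm n 2,
    Nat.sub_self, Nat.factorial_zero, one_mul] at h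
  have h4 := Nat.factorial_eq_mul_doubleFactorial (2 * n - 1)
  rw [Nat.sub_add_cancel (by omega), Nat.doubleFactorial_two_mul, ← h, mul_comm] at h4
  exact Nat.eq_of_mul_eq_mul_left (by positivity) h4

/-- If for every diagram with marked vertex the orderings of the labels producing `p` excluded
pairs have proportion `q`, then `q` is the probability of `p` excluded pairs. -/
theorem excludedProb_eq_of_card_perm {n p : ℕ} (hn : 1 ≤ n) {q : ℝ}
    (h : ∀ (σ : Equiv.Perm (Fin (2 * n))) (i : Fin (2 * n)), IsChordDiagram σ →
      ((Finset.univ.filter fun g : Equiv.Perm (Fin (2 * n)) =>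
        (exclusionSet σ i g).card = 2 * p).card : ℝ) = (2 * n).factorial * q) :
    excludedProb n p = q := by
  have h1 := congrArg (Nat.cast : ℕ → ℝ) (sum_card_perm_exclusionSet n p)
  have hc : (Finset.univ.filter fun c : Equiv.Perm (Fin (2 * n)) × Fin (2 * n) =>
      IsChordDiagram c.1).card = Nat.doubleFactorial (2 * n - 1) * (2 * n) := by
    have e : (Finset.univ.filter fun c : Equiv.Perm (Fin (2 * n)) × Fin (2 * n) =>
        IsChordDiagram c.1) = (Finset.univ.filter fun σ => IsChordDiagram σ) ×ˢ Finset.univ := by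
      ext c; simp
    rw [e, Finset.card_product, card_isChordDiagram hn, Finset.card_univ, Fintype.card_fin]
  rw [Nat.cast_sum, Finset.sum_congr rfl fun c hc => h c.1 c.2 (Finset.mem_filter.1 hc).2,
    Finset.sum_const, hc] at h1
  push_cast [nsmul_eq_mul] at h1
  have hf : ((2 * n).factorial : ℝ) ≠ 0 := by positivity
  have hd : (Nat.doubleFactorial (2 * n - 1) : ℝ) ≠ 0 := by
    exact_mod_cast (Nat.doubleFactorial_pos _).ne'
  have hn' : (n : ℝ) ≠ 0 := by positivity
  rw [excludedProb, div_eq_iff (mul_ne_zero hn' hd)]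
  have h2 : ((2 * n).factorial : ℝ) * (2 * excludedCount n p) =
      (2 * n).factorial * (2 * (q * (n * Nat.doubleFactorial (2 * n - 1)))) := by
    rw [← h1]; ring
  linarith [mul_left_cancel₀ hf h2]

/-! ### The limiting density as an angle -/

section

open MeasureTheory Set Filter Topology

theorem excludedDensity_eq (x : ℝ) :
    excludedDensity x = Real.pi / 2 - 2 * Real.arctan (Real.sqrt (2 * x - 1)) := by
  unfold excludedDensity
  split_ifs with h
  · rw [Real.sqrt_eq_zero_of_nonpos (by linarith)]; simp
  · rfl

theorem continuous_excludedDensity : Continuous excludedDensity := by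
  have : excludedDensity = fun x => Real.pi / 2 - 2 * Real.arctan (Real.sqrt (2 * x - 1)) :=
    funext excludedDensity_eq
  rw [this]
  fun_prop

theorem excludedDensity_le (x : ℝ) : excludedDensity x ≤ Real.pi / 2 := by
  rw [excludedDensity_eq]
  have := Real.arctan_nonneg.2 (Real.sqrt_nonneg (2 * x - 1))
  linarith

theorem excludedDensity_nonneg {x : ℝ} (hx : x ≤ 1) : 0 ≤ excludedDensity x := by
  rw [excludedDensity_eq]
  have h : Real.arctan (Real.sqrt (2 * x - 1)) ≤ Real.arctan 1 :=
    Real.arctan_mono (Real.sqrt_le_one.2 (by linarith))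
  rw [Real.arctan_one] at h
  linarith

theorem excludedDensity_nonpos {x : ℝ} (hx : 1 ≤ x) : excludedDensity x ≤ 0 := by
  rw [excludedDensity_eq]
  have h : Real.arctan 1 ≤ Real.arctan (Real.sqrt (2 * x - 1)) :=
    Real.arctan_mono (Real.one_le_sqrt.2 (by linarith))
  rw [Real.arctan_one] at h
  linarith

/-- The directions in which a point at distance `r` from the origin lies in the open simplex. -/
theorem volume_simplex_angles {r : ℝ} (hr : 0 < r) :
    volume {θ : ℝ | θ ∈ Ioo (-Real.pi) Real.pi ∧ 0 ≤ r * Real.cos θ ∧ 0 ≤ r * Real.sin θ ∧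
      r * Real.cos θ + r * Real.sin θ < 1} = ENNReal.ofReal (excludedDensity (r ^ 2)) := by
  have hpi := Real.pi_pos
  have hquad : ∀ θ : ℝ, (θ ∈ Ioo (-Real.pi) Real.pi ∧ 0 ≤ r * Real.cos θ ∧
      0 ≤ r * Real.sin θ) ↔ θ ∈ Icc 0 (Real.pi / 2) := by
    intro θ
    rw [mul_nonneg_iff_of_pos_left hr, mul_nonneg_iff_of_pos_left hr]
    constructor
    · rintro ⟨⟨h1, h2⟩, hc, hs⟩
      constructor
      · by_contra! h
        exact absurd (Real.sin_neg_of_neg_of_neg_pi_lt h h1) (not_lt.2 hs)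
      · by_contra! h
        exact absurd (Real.cos_neg_of_pi_div_two_lt_of_lt h (by linarith)) (not_lt.2 hc)
    · rintro ⟨h1, h2⟩
      exact ⟨⟨by linarith, by linarith⟩, Real.cos_nonneg_of_mem_Icc ⟨by linarith, h2⟩,
        Real.sin_nonneg_of_nonneg_of_le_pi h1 (by linarith)⟩
  have hsum : ∀ θ : ℝ, r * Real.cos θ + r * Real.sin θ =
      Real.sqrt 2 * r * Real.cos (θ - Real.pi / 4) := by
    intro θ
    rw [Real.cos_sub, Real.cos_pi_div_four, Real.sin_pi_div_four]
    have : Real.sqrt 2 * Real.sqrt 2 = 2 := Real.mul_self_sqrt (by norm_num)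
    linear_combination (- r * (Real.cos θ + Real.sin θ) / 2) * this
  have hset : {θ : ℝ | θ ∈ Ioo (-Real.pi) Real.pi ∧ 0 ≤ r * Real.cos θ ∧ 0 ≤ r * Real.sin θ ∧
      r * Real.cos θ + r * Real.sin θ < 1} =
      {θ | θ ∈ Icc 0 (Real.pi / 2) ∧ Real.sqrt 2 * r * Real.cos (θ - Real.pi / 4) < 1} := by
    ext θ
    simp only [mem_ofPred_eq, ← hquad, hsum]
    tauto
  rw [hset]
  have h2r : (Real.sqrt 2 * r) ^ 2 = 2 * r ^ 2 := by
    rw [mul_pow, Real.sq_sqrt (by norm_num)]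
  have h2r0 : 0 < Real.sqrt 2 * r := by positivity
  by_cases h : r ^ 2 < 1 / 2
  · have : {θ | θ ∈ Icc 0 (Real.pi / 2) ∧ Real.sqrt 2 * r * Real.cos (θ - Real.pi / 4) < 1} =
        Icc 0 (Real.pi / 2) := by
      ext θ
      simp only [mem_ofPred_eq, and_iff_left_iff_imp]
      intro _
      have h1 : Real.sqrt 2 * r < 1 := by nlinarith
      nlinarith [Real.cos_le_one (θ - Real.pi / 4)]
    rw [this, Real.volume_Icc, excludedDensity, if_pos h, sub_zero]
  -- Here `c` satisfies `cos c = 1 / (√2 r)`, so the admissible directions are those of the quadrant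
  -- at angle more than `c` from the diagonal `π / 4`.
  · rw [excludedDensity_eq]
    set c := Real.arctan (Real.sqrt (2 * r ^ 2 - 1)) with hc
    have hc0 : 0 ≤ c := Real.arctan_nonneg.2 (Real.sqrt_nonneg _)
    have hc1 : c < Real.pi / 2 := Real.arctan_lt_pi_div_two _
    have hcos : Real.sqrt 2 * r * Real.cos c = 1 := by
      rw [hc, Real.cos_arctan, Real.sq_sqrt (by linarith), add_sub_cancel, ← h2r,
        Real.sqrt_sq h2r0.le]
      field_simp
    have : {θ | θ ∈ Icc 0 (Real.pi / 2) ∧ Real.sqrt 2 * r * Real.cos (θ - Real.pi / 4) < 1} =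
        Ico 0 (Real.pi / 4 - c) ∪ Ioc (Real.pi / 4 + c) (Real.pi / 2) := by
      ext θ
      simp only [mem_ofPred_eq, mem_union, mem_Ico, mem_Ioc, mem_Icc]
      rw [← hcos, mul_lt_mul_iff_right₀ h2r0, ← Real.cos_abs (θ - Real.pi / 4)]
      have key : 0 ≤ θ → θ ≤ Real.pi / 2 →
          (Real.cos |θ - Real.pi / 4| < Real.cos c ↔ c < |θ - Real.pi / 4|) := by
        intro h0 h1
        have habs : |θ - Real.pi / 4| ≤ Real.pi / 4 := abs_le.2 ⟨by linarith, by linarith⟩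
        exact Real.strictAntiOn_cos.lt_iff_gt ⟨abs_nonneg _, by linarith⟩ ⟨hc0, by linarith⟩
      constructor
      · rintro ⟨⟨h0, h1⟩, h3⟩
        rw [key h0 h1, lt_abs] at h3
        rcases h3 with h3 | h3
        · right; exact ⟨by linarith, h1⟩
        · left; exact ⟨h0, by linarith⟩
      · rintro (⟨h0, h1⟩ | ⟨h0, h1⟩)
        · refine ⟨⟨h0, by linarith⟩, ?_⟩
          rw [key h0 (by linarith), lt_abs]
          right; linarith
        · refine ⟨⟨by linarith, h1⟩, ?_⟩
          rw [key (by linarith) h1, lt_abs]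
          left; linarith
    rw [this, measure_union _ measurableSet_Ioc, Real.volume_Ico, Real.volume_Ioc]
    -- When `c ≥ π / 4`, that is `r ≥ 1`, both arcs are empty and `ENNReal.ofReal` truncates the
    -- nonpositive density to 0.
    · rcases le_total 0 (Real.pi / 4 - c) with h4 | h4
      · rw [← ENNReal.ofReal_add (by linarith) (by linarith)]
        congr 1; ring
      · rw [ENNReal.ofReal_of_nonpos (by linarith), ENNReal.ofReal_of_nonpos (by linarith),
          ENNReal.ofReal_of_nonpos (by linarith), add_zero]
    · rw [Set.disjoint_left]
      rintro θ ⟨_, h1⟩ ⟨h2, _⟩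
      linarith

/-- The open standard simplex in the plane, with its two legs. -/
def planeSimplex : Set (ℝ × ℝ) := {z | 0 ≤ z.1 ∧ 0 ≤ z.2 ∧ z.1 + z.2 < 1}

theorem measurableSet_planeSimplex : MeasurableSet planeSimplex := by
  unfold planeSimplex
  measurability

theorem lintegral_planeSimplex {H : ℝ → ENNReal} (hH : Measurable H) :
    ∫⁻ z in planeSimplex, H (z.1 ^ 2 + z.2 ^ 2) =
      ∫⁻ r in Ioi (0 : ℝ), ENNReal.ofReal r * H (r ^ 2) *
        ENNReal.ofReal (excludedDensity (r ^ 2)) := by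
  have hm : Measurable (planeSimplex.indicator fun z : ℝ × ℝ => H (z.1 ^ 2 + z.2 ^ 2)) :=
    (by fun_prop : Measurable fun z : ℝ × ℝ => H (z.1 ^ 2 + z.2 ^ 2)).indicator
      measurableSet_planeSimplex
  have hpol : Measurable (polarCoord.symm : ℝ × ℝ → ℝ × ℝ) :=
    continuous_polarCoord_symm.measurable
  rw [← lintegral_indicator measurableSet_planeSimplex, ← lintegral_comp_polarCoord_symm,
    polarCoord_target, Measure.volume_eq_prod, ← Measure.prod_restrict, lintegral_prod]
  · refine setLIntegral_congr_fun measurableSet_Ioi fun r hr => ?_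
    have hr : 0 < r := hr
    rw [← volume_simplex_angles hr]
    have hS : MeasurableSet {θ : ℝ | 0 ≤ r * Real.cos θ ∧ 0 ≤ r * Real.sin θ ∧
        r * Real.cos θ + r * Real.sin θ < 1} := by measurability
    have hi : ∀ θ : ℝ, ENNReal.ofReal r • planeSimplex.indicator
        (fun z : ℝ × ℝ => H (z.1 ^ 2 + z.2 ^ 2)) (polarCoord.symm (r, θ)) =
        {θ : ℝ | 0 ≤ r * Real.cos θ ∧ 0 ≤ r * Real.sin θ ∧
          r * Real.cos θ + r * Real.sin θ < 1}.indicator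
          (fun _ => ENNReal.ofReal r * H (r ^ 2)) θ := by
      intro θ
      have e : (r * Real.cos θ) ^ 2 + (r * Real.sin θ) ^ 2 = r ^ 2 := by
        linear_combination r ^ 2 * Real.cos_sq_add_sin_sq θ
      simp only [indicator, planeSimplex, polarCoord_symm_apply, mem_ofPred_eq, e, smul_eq_mul]
      split_ifs <;> simp
    simp only [hi]
    rw [lintegral_indicator hS, lintegral_const, Measure.restrict_restrict hS,
      Measure.restrict_apply_univ, inter_comm]
    rfl
  · exact ((ENNReal.measurable_ofReal.comp measurable_fst).smul (hm.comp hpol)).aemeasurable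

/-- Each of the two triangles cut off by the diagonal is carried onto `planeSimplex` by the
measure-preserving map to `(min, 1 - max)`; the diagonal is null. -/
theorem lintegral_unitSquare_spread {H : ℝ → ENNReal} (hH : Measurable H) :
    ∫⁻ z, H (min z.1 z.2 ^ 2 + (1 - max z.1 z.2) ^ 2)
      ∂((volume.restrict (Icc (0 : ℝ) 1)).prod (volume.restrict (Icc (0 : ℝ) 1))) =
    2 * ∫⁻ r in Ioi (0 : ℝ), ENNReal.ofReal r * H (r ^ 2) *
        ENNReal.ofReal (excludedDensity (r ^ 2)) := by
  set F : ℝ × ℝ → ENNReal := fun z => H (min z.1 z.2 ^ 2 + (1 - max z.1 z.2) ^ 2) with hF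
  have hFm : Measurable F := by fun_prop
  set Q : Set (ℝ × ℝ) := Icc (0 : ℝ) 1 ×ˢ Icc (0 : ℝ) 1 with hQ
  have hQm : MeasurableSet Q := measurableSet_Icc.prod measurableSet_Icc
  have hlt : MeasurableSet {z : ℝ × ℝ | z.1 < z.2} := measurableSet_lt measurable_fst measurable_snd
  have hgt : MeasurableSet {z : ℝ × ℝ | z.2 < z.1} := measurableSet_lt measurable_snd measurable_fst
  have hdiag : volume {z : ℝ × ℝ | z.1 = z.2} = 0 := by
    rw [Measure.volume_eq_prod, Measure.measure_prod_null
      (measurableSet_eq_fun measurable_fst measurable_snd)]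
    refine Filter.Eventually.of_forall fun a => ?_
    have : Prod.mk a ⁻¹' {z : ℝ × ℝ | z.1 = z.2} = {a} := by ext b; simp [eq_comm]
    simp [this]
  rw [Measure.prod_restrict, ← Measure.volume_eq_prod, ← hQ]
  have h1 : ∫⁻ z in Q ∩ {z | z.1 < z.2}, F z =
      ∫⁻ r in Ioi (0 : ℝ), ENNReal.ofReal r * H (r ^ 2) *
        ENNReal.ofReal (excludedDensity (r ^ 2)) := by
    rw [← lintegral_planeSimplex hH, ← lintegral_indicator (hQm.inter hlt),
      ← lintegral_indicator measurableSet_planeSimplex]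
    have hmp : MeasurePreserving (Prod.map id fun b : ℝ => 1 - b) (volume : Measure (ℝ × ℝ))
        volume := by
      rw [Measure.volume_eq_prod]
      exact (MeasurePreserving.id _).prod (Measure.measurePreserving_sub_left volume 1)
    rw [← hmp.lintegral_comp ((by fun_prop : Measurable fun z : ℝ × ℝ =>
      H (z.1 ^ 2 + z.2 ^ 2)).indicator measurableSet_planeSimplex)]
    refine lintegral_congr fun z => ?_
    have hiff : z ∈ Q ∩ {z | z.1 < z.2} ↔ Prod.map id (fun b : ℝ => 1 - b) z ∈ planeSimplex := by
      simp only [hQ, planeSimplex, mem_inter_iff, mem_prod, mem_Icc, mem_ofPred_eq, Prod.map_fst,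
        Prod.map_snd, id]
      constructor
      · rintro ⟨⟨⟨_, _⟩, _, _⟩, _⟩; refine ⟨?_, ?_, ?_⟩ <;> linarith
      · rintro ⟨_, _, _⟩; refine ⟨⟨⟨?_, ?_⟩, ?_, ?_⟩, ?_⟩ <;> linarith
    by_cases hz : z ∈ Q ∩ {z | z.1 < z.2}
    · rw [indicator_of_mem hz, indicator_of_mem (hiff.1 hz)]
      have hlt : z.1 < z.2 := hz.2
      simp [hF, min_eq_left hlt.le, max_eq_right hlt.le]
    · rw [indicator_of_notMem hz, indicator_of_notMem (mt hiff.2 hz)]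
  have h2 : ∫⁻ z in Q ∩ {z | z.2 < z.1}, F z = ∫⁻ z in Q ∩ {z | z.1 < z.2}, F z := by
    rw [← lintegral_indicator (hQm.inter hlt), ← lintegral_indicator (hQm.inter hgt)]
    have hmp : MeasurePreserving (Prod.swap : ℝ × ℝ → ℝ × ℝ) volume volume := by
      rw [Measure.volume_eq_prod]; exact Measure.measurePreserving_swap
    rw [← hmp.lintegral_comp (hFm.indicator (hQm.inter hlt))]
    refine lintegral_congr fun z => ?_
    simp only [indicator, hQ, hF, mem_inter_iff, mem_prod, mem_ofPred_eq, Prod.fst_swap,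
      Prod.snd_swap, min_comm z.2, max_comm z.2, and_comm (a := z.2 ∈ Icc (0 : ℝ) 1)]
  rw [← lintegral_inter_add_sdiff F Q hlt, h1]
  have h3 : (Q \ {z : ℝ × ℝ | z.1 < z.2} : Set (ℝ × ℝ)) =ᵐ[volume]
      (Q ∩ {z : ℝ × ℝ | z.2 < z.1} : Set (ℝ × ℝ)) := by
    have : ∀ᵐ z : ℝ × ℝ, z.1 ≠ z.2 := by rw [ae_iff]; simpa using hdiag
    filter_upwards [this] with z hz
    refine propext (and_congr_right fun _ => ?_)
    simp only [mem_ofPred_eq]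
    exact ⟨fun h => lt_of_le_of_ne (not_lt.1 h) hz.symm, fun h => not_lt.2 (le_of_lt h)⟩
  rw [setLIntegral_congr h3, h2, h1, two_mul]

/-! ### Independent uniform positions induce a uniform ordering -/

/-- The uniform distribution on the unit interval. -/
noncomputable def uniformUnit : Measure ℝ := volume.restrict (Icc (0 : ℝ) 1)

instance : IsProbabilityMeasure uniformUnit :=
  ⟨by simp [uniformUnit]⟩

/-- The positions `x` that order the labels as `g` does. -/
def orderCell {N : ℕ} (g : Equiv.Perm (Fin N)) : Set (Fin N → ℝ) :=
  {x | ∀ k l, x k < x l ↔ g k < g l}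

theorem measurableSet_orderCell {N : ℕ} (g : Equiv.Perm (Fin N)) :
    MeasurableSet (orderCell g) := by
  have : orderCell g = ⋂ k, ⋂ l, {x : Fin N → ℝ | x k < x l ↔ g k < g l} := by
    ext x; simp [orderCell]
  rw [this]
  refine MeasurableSet.iInter fun k => MeasurableSet.iInter fun l => ?_
  have hm : MeasurableSet {x : Fin N → ℝ | x k < x l} :=
    measurableSet_lt (measurable_pi_apply k) (measurable_pi_apply l)
  by_cases h : g k < g l
  · simpa [h] using hm
  · simp only [h, iff_false]
    exact hm.compl

/-- A point in both cells would make `g' * g⁻¹` an order automorphism of `Fin N`, and the only one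
is the identity. -/
theorem disjoint_orderCell {N : ℕ} {g g' : Equiv.Perm (Fin N)} (h : g ≠ g') :
    Disjoint (orderCell g) (orderCell g') := by
  rw [Set.disjoint_left]
  intro x hx hx'
  apply h
  have hm : StrictMono (g' * g⁻¹ : Equiv.Perm (Fin N)) := by
    intro a b hab
    have h1 := hx (g⁻¹ a) (g⁻¹ b)
    have h2 := hx' (g⁻¹ a) (g⁻¹ b)
    exact h2.1 (h1.2 (by simpa using hab))
  have h1 : (g' * g⁻¹ : Equiv.Perm (Fin N)) = 1 := by
    have := Subsingleton.elim (hm.orderIsoOfSurjective _ (g' * g⁻¹ : Equiv.Perm (Fin N)).surjective)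
      (OrderIso.refl _)
    ext a
    have h2 := congrArg (fun f : Fin N ≃o Fin N => (f a : ℕ)) this
    simpa using h2
  exact (mul_inv_eq_one.1 h1).symm

theorem exists_mem_orderCell {N : ℕ} {x : Fin N → ℝ} (hx : Function.Injective x) :
    ∃ g, x ∈ orderCell g := by
  refine ⟨(Tuple.sort x)⁻¹, fun k l => ?_⟩
  have hm : StrictMono (x ∘ Tuple.sort x) :=
    (Tuple.monotone_sort x).strictMono_of_injective (hx.comp (Tuple.sort x).injective)
  have := hm.lt_iff_lt (a := (Tuple.sort x)⁻¹ k) (b := (Tuple.sort x)⁻¹ l)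
  simpa using this

theorem ae_injective_uniformUnit (N : ℕ) :
    ∀ᵐ x ∂(Measure.pi fun _ : Fin N => uniformUnit), Function.Injective x := by
  have hac : Measure.pi (fun _ : Fin N => uniformUnit) ≪ (volume : Measure (Fin N → ℝ)) := by
    unfold uniformUnit
    rw [← Measure.restrict_pi_pi]
    exact Measure.absolutelyContinuous_restrict
  refine hac.ae_le ?_
  -- The coincidence locus of two coordinates is a proper subspace, hence null.
  have : ∀ k l : Fin N, k ≠ l → ∀ᵐ x : Fin N → ℝ, x k ≠ x l := by
    intro k l hkl
    let S : Submodule ℝ (Fin N → ℝ) :=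
      LinearMap.ker ((LinearMap.proj k : (Fin N → ℝ) →ₗ[ℝ] ℝ) - LinearMap.proj l)
    have hS : S ≠ ⊤ := by
      intro h
      have : Pi.single k (1 : ℝ) ∈ S := by rw [h]; trivial
      simp [S, hkl.symm] at this
    rw [ae_iff]
    convert! Measure.addHaar_submodule volume S hS using 2
    ext x
    simp [S, sub_eq_zero]
  have h2 : ∀ᵐ x : Fin N → ℝ, ∀ k l, k ≠ l → x k ≠ x l := by
    rw [ae_all_iff]; intro k
    rw [ae_all_iff]; intro l
    by_cases h : k = l
    · simp [h]
    · simpa [h] using this k l h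
  filter_upwards [h2] with x hx k l hkl
  by_contra h
  exact hx k l h hkl

/-- The product measure is invariant under permuting the coordinates, which permutes the cells
transitively. -/
theorem measure_orderCell {N : ℕ} (g : Equiv.Perm (Fin N)) :
    Measure.pi (fun _ : Fin N => uniformUnit) (orderCell g) =
      Measure.pi (fun _ : Fin N => uniformUnit) (orderCell 1) := by
  have hmeas : Measurable fun x : Fin N → ℝ => fun k => x (g⁻¹ k) := by fun_prop
  have hmap : Measure.pi (fun _ : Fin N => uniformUnit) =
      (Measure.pi fun _ : Fin N => uniformUnit).map fun x => fun k => x (g⁻¹ k) := by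
    refine Measure.pi_eq fun s hs => ?_
    rw [Measure.map_apply hmeas (MeasurableSet.univ_pi hs)]
    have : (fun x : Fin N → ℝ => fun k => x (g⁻¹ k)) ⁻¹' univ.pi s =
        univ.pi fun k => s (g k) := by
      ext x
      simp only [mem_preimage, mem_univ_pi]
      exact ⟨fun h k => by simpa using h (g k), fun h k => by simpa using h (g⁻¹ k)⟩
    rw [this, Measure.pi_pi]
    exact Equiv.prod_comp g fun k => uniformUnit (s k)
  conv_rhs => rw [hmap, Measure.map_apply hmeas (measurableSet_orderCell 1)]
  congr 1
  ext x
  simp only [orderCell, mem_preimage, mem_ofPred_eq, Equiv.Perm.one_apply]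
  refine ⟨fun h k l => ?_, fun h k l => ?_⟩
  · simpa using h (g⁻¹ k) (g⁻¹ l)
  · simpa using h (g k) (g l)

theorem sum_measure_orderCell {N : ℕ} {P : (Fin N → ℝ) → Prop}
    {Q : Equiv.Perm (Fin N) → Prop} [DecidablePred Q]
    (h : ∀ g, ∀ x ∈ orderCell g, (P x ↔ Q g)) :
    Measure.pi (fun _ : Fin N => uniformUnit) {x | P x} =
      (Finset.univ.filter Q).card * Measure.pi (fun _ : Fin N => uniformUnit) (orderCell 1) := by
  have h1 : ({x | P x} : Set (Fin N → ℝ)) =ᵐ[Measure.pi fun _ : Fin N => uniformUnit]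
      (⋃ g ∈ Finset.univ.filter Q, orderCell g : Set (Fin N → ℝ)) := by
    filter_upwards [ae_injective_uniformUnit N] with x hx
    obtain ⟨g, hg⟩ := exists_mem_orderCell hx
    apply propext
    change P x ↔ x ∈ ⋃ g ∈ Finset.univ.filter Q, orderCell g
    simp only [mem_iUnion, Finset.mem_filter, Finset.mem_univ, true_and, exists_prop]
    exact ⟨fun hp => ⟨g, (h g x hg).1 hp, hg⟩, fun ⟨g', hq, hg'⟩ => (h g' x hg').2 hq⟩
  rw [measure_congr h1, measure_biUnion_finset
    (fun g _ g' _ hgg' => disjoint_orderCell hgg') fun g _ => measurableSet_orderCell g,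
    Finset.sum_congr rfl fun g _ => measure_orderCell g, Finset.sum_const, nsmul_eq_mul]

theorem card_perm_eq_factorial_mul {N : ℕ} {P : (Fin N → ℝ) → Prop}
    {Q : Equiv.Perm (Fin N) → Prop} [DecidablePred Q]
    (h : ∀ g, ∀ x ∈ orderCell g, (P x ↔ Q g)) :
    ((Finset.univ.filter Q).card : ENNReal) =
      N.factorial * Measure.pi (fun _ : Fin N => uniformUnit) {x | P x} := by
  -- The trivial event shows that each of the `N!` cells has measure `1 / N!`.
  have h1 := sum_measure_orderCell (N := N) (P := fun _ => True) (Q := fun _ => True)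
    fun _ _ _ => Iff.rfl
  rw [Finset.filter_true, Finset.card_univ, Fintype.card_perm, Fintype.card_fin] at h1
  simp only [ofPred_true, measure_univ] at h1
  rw [sum_measure_orderCell h, mul_left_comm, ← h1, mul_one]

/-! ### Conditioning on the marked pair -/

/-- The number of successes among independent trials has the binomial distribution. -/
theorem pi_card_mem_eq {ι Ω : Type*} [Fintype ι] [DecidableEq ι] [MeasurableSpace Ω]
    (μ : Measure Ω) [IsProbabilityMeasure μ] {A : Set Ω} [DecidablePred (· ∈ A)]
    (hA : MeasurableSet A) (p : ℕ) :
    Measure.pi (fun _ : ι => μ) {y | (Finset.univ.filter fun j => y j ∈ A).card = p} =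
      (Fintype.card ι).choose p * (μ A ^ p * μ Aᶜ ^ (Fintype.card ι - p)) := by
  have h1 : {y : ι → Ω | (Finset.univ.filter fun j => y j ∈ A).card = p} =
      ⋃ s ∈ Finset.powersetCard p (Finset.univ : Finset ι),
        univ.pi fun j => if j ∈ s then A else Aᶜ := by
    ext y
    simp only [mem_ofPred_eq, mem_iUnion, Finset.mem_powersetCard_univ, exists_prop, mem_univ_pi]
    constructor
    · intro h
      refine ⟨_, h, fun j => ?_⟩
      by_cases hj : y j ∈ A <;> simp [hj]
    · rintro ⟨s, hs, h⟩
      rw [← hs]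
      congr 1
      ext j
      have := h j
      by_cases hj : j ∈ s <;> simp_all
  rw [h1, measure_biUnion_finset]
  · have : ∀ s ∈ Finset.powersetCard p (Finset.univ : Finset ι),
        Measure.pi (fun _ : ι => μ) (univ.pi fun j => if j ∈ s then A else Aᶜ) =
          μ A ^ p * μ Aᶜ ^ (Fintype.card ι - p) := by
      intro s hs
      rw [Finset.mem_powersetCard_univ] at hs
      rw [Measure.pi_pi]
      simp only [apply_ite μ]
      rw [Finset.prod_ite, Finset.prod_const, Finset.prod_const]
      congr 2
      · rw [← hs]; congr 1; ext; simp
      · rw [← hs, ← Finset.card_compl]; congr 1; ext; simp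
    rw [Finset.sum_congr rfl this, Finset.sum_const, Finset.card_powersetCard, Finset.card_univ,
      nsmul_eq_mul]
  · intro s _ t _ hst
    rw [Function.onFun, Set.disjoint_left]
    intro y hy hy'
    apply hst
    ext j
    have h1 := hy j trivial
    have h2 := hy' j trivial
    by_cases hs : j ∈ s <;> by_cases ht : j ∈ t <;> simp_all
  · intro s _
    refine MeasurableSet.univ_pi fun j => ?_
    split_ifs
    exacts [hA, hA.compl]

/-- The left endpoints of the pairs other than the one of `i`. -/
def otherLeft {n : ℕ} (σ : Equiv.Perm (Fin (2 * n))) (i : Fin (2 * n)) : Finset (Fin (2 * n)) :=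
  (Finset.univ.filter fun k => k ≠ i ∧ k ≠ σ i).filter fun k => k < σ k

theorem mem_otherLeft {n : ℕ} {σ : Equiv.Perm (Fin (2 * n))} {i k : Fin (2 * n)} :
    k ∈ otherLeft σ i ↔ (k ≠ i ∧ k ≠ σ i) ∧ k < σ k := by
  simp [otherLeft]

theorem partner_ne {n : ℕ} {σ : Equiv.Perm (Fin (2 * n))} (h : IsChordDiagram σ)
    {i k : Fin (2 * n)} (hk : k ≠ i ∧ k ≠ σ i) : σ k ≠ i ∧ σ k ≠ σ i := by
  refine ⟨fun e => hk.2 ?_, fun e => hk.1 (σ.injective e)⟩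
  rw [← e, (h k).1]

theorem partner_mem_otherLeft {n : ℕ} {σ : Equiv.Perm (Fin (2 * n))} (h : IsChordDiagram σ)
    {i k : Fin (2 * n)} (hk : k ≠ i ∧ k ≠ σ i) (hlt : ¬ k < σ k) : σ k ∈ otherLeft σ i := by
  rw [mem_otherLeft, (h k).1]
  exact ⟨partner_ne h hk, lt_of_le_of_ne (not_lt.1 hlt) (h k).2⟩

theorem card_otherLeft {n : ℕ} {σ : Equiv.Perm (Fin (2 * n))} (h : IsChordDiagram σ)
    (i : Fin (2 * n)) : (otherLeft σ i).card = n - 1 := by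
  have h1 := h.card_eq_two_mul (s := Finset.univ.filter fun k => k ≠ i ∧ k ≠ σ i) (by
    intro k hk
    simp only [Finset.mem_filter, Finset.mem_univ, true_and] at hk ⊢
    exact partner_ne h hk)
  have h2 : (Finset.univ.filter fun k => k ≠ i ∧ k ≠ σ i) = ({i, σ i} : Finset _)ᶜ := by
    ext k; simp
  rw [h2, Finset.card_compl, Finset.card_pair (h i).2.symm, Fintype.card_fin, ← h2] at h1
  rw [otherLeft]
  omega

/-- Positions of the labels assembled from those of the marked pair and of the other pairs. -/
def assemble {n : ℕ} (σ : Equiv.Perm (Fin (2 * n))) (h : IsChordDiagram σ) (i : Fin (2 * n))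
    (z : (ℝ × ℝ) × (otherLeft σ i → ℝ × ℝ)) (k : Fin (2 * n)) : ℝ :=
  if h1 : k = i then z.1.1 else if h2 : k = σ i then z.1.2 else
    if hlt : k < σ k then (z.2 ⟨k, mem_otherLeft.2 ⟨⟨h1, h2⟩, hlt⟩⟩).1
    else (z.2 ⟨σ k, partner_mem_otherLeft h ⟨h1, h2⟩ hlt⟩).2

section assemble
variable {n : ℕ} {σ : Equiv.Perm (Fin (2 * n))} (h : IsChordDiagram σ) (i : Fin (2 * n))
  (z : (ℝ × ℝ) × (otherLeft σ i → ℝ × ℝ))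

theorem assemble_marked : assemble σ h i z i = z.1.1 := by simp [assemble]

theorem assemble_marked_partner : assemble σ h i z (σ i) = z.1.2 := by
  simp [assemble, (h i).2]

theorem assemble_left (j : otherLeft σ i) : assemble σ h i z j = (z.2 j).1 := by
  have hj := mem_otherLeft.1 j.2
  simp [assemble, hj.1.1, hj.1.2, hj.2]

theorem assemble_right (j : otherLeft σ i) : assemble σ h i z (σ j) = (z.2 j).2 := by
  have hj := mem_otherLeft.1 j.2
  have hp := partner_ne h hj.1
  have hlt : ¬ σ (j : Fin (2 * n)) < σ (σ j) := by rw [(h j).1]; exact not_lt.2 hj.2.le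
  rw [assemble, dif_neg hp.1, dif_neg hp.2, dif_neg hlt]
  have e : (⟨σ (σ j), partner_mem_otherLeft h hp hlt⟩ : otherLeft σ i) = j := Subtype.ext (h j).1
  rw [e]

theorem measurable_assemble : Measurable (assemble σ h i) := by
  refine measurable_pi_lambda _ fun k => ?_
  unfold assemble
  split_ifs <;> fun_prop

theorem label_cases {n : ℕ} {σ : Equiv.Perm (Fin (2 * n))} (h : IsChordDiagram σ)
    (i k : Fin (2 * n)) :
    k = i ∨ k = σ i ∨ (∃ j : otherLeft σ i, k = j) ∨ ∃ j : otherLeft σ i, k = σ j := by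
  by_cases h1 : k = i
  · exact Or.inl h1
  by_cases h2 : k = σ i
  · exact Or.inr (Or.inl h2)
  by_cases h3 : k < σ k
  · exact Or.inr (Or.inr (Or.inl ⟨⟨k, mem_otherLeft.2 ⟨⟨h1, h2⟩, h3⟩⟩, rfl⟩))
  · exact Or.inr (Or.inr (Or.inr ⟨⟨σ k, partner_mem_otherLeft h ⟨h1, h2⟩ h3⟩, (h k).1.symm⟩))

/-- Grouping the labels by pairs; `map_assemble` uses it to compare the measures of boxes. -/
theorem prod_labels {M : Type*} [CommMonoid M] {n : ℕ} {σ : Equiv.Perm (Fin (2 * n))}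
    (h : IsChordDiagram σ) (i : Fin (2 * n)) (f : Fin (2 * n) → M) :
    ∏ k, f k = (f i * f (σ i)) * ∏ j : otherLeft σ i, (f j * f (σ j)) := by
  rw [Finset.prod_coe_sort (otherLeft σ i) fun j => f j * f (σ j), Finset.prod_mul_distrib]
  have hinj : Set.InjOn σ (otherLeft σ i : Set (Fin (2 * n))) := σ.injective.injOn
  rw [← Finset.prod_image (f := f) hinj, ← Finset.prod_pair (f := f) (h i).2.symm,
    ← Finset.prod_union, ← Finset.prod_union]
  · congr 1
    symm
    rw [Finset.eq_univ_iff_forall]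
    intro k
    rcases label_cases h i k with h1 | h1 | ⟨j, h1⟩ | ⟨j, h1⟩ <;> simp [h1]
  · rw [Finset.disjoint_left]
    intro k hk hk'
    have hne : k ≠ i ∧ k ≠ σ i := by
      rw [Finset.mem_union, Finset.mem_image] at hk'
      rcases hk' with hk' | ⟨j, hj, rfl⟩
      · exact (mem_otherLeft.1 hk').1
      · exact partner_ne h (mem_otherLeft.1 hj).1
    simp [hne] at hk
  · rw [Finset.disjoint_left]
    intro k hk hk'
    rw [Finset.mem_image] at hk'
    obtain ⟨j, hj, rfl⟩ := hk'
    have h1 := (mem_otherLeft.1 hj).2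
    have h2 := (mem_otherLeft.1 hk).2
    rw [(h j).1] at h2
    exact absurd h1 (not_lt.2 h2.le)

theorem map_assemble :
    ((uniformUnit.prod uniformUnit).prod
      (Measure.pi fun _ : otherLeft σ i => uniformUnit.prod uniformUnit)).map (assemble σ h i) =
    Measure.pi fun _ : Fin (2 * n) => uniformUnit := by
  symm
  refine Measure.pi_eq fun s hs => ?_
  rw [Measure.map_apply (measurable_assemble h i) (MeasurableSet.univ_pi hs)]
  have : assemble σ h i ⁻¹' univ.pi s =
      (s i ×ˢ s (σ i)) ×ˢ univ.pi fun j : otherLeft σ i => s j ×ˢ s (σ j) := by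
    ext z
    simp only [mem_preimage, mem_univ_pi, mem_prod]
    constructor
    · intro hz
      refine ⟨⟨?_, ?_⟩, fun j => ⟨?_, ?_⟩⟩
      · simpa [assemble_marked] using hz i
      · simpa [assemble_marked_partner] using hz (σ i)
      · simpa [assemble_left] using hz j
      · simpa [assemble_right] using hz (σ j)
    · rintro ⟨⟨hz1, hz2⟩, hz3⟩ k
      rcases label_cases h i k with rfl | rfl | ⟨j, rfl⟩ | ⟨j, rfl⟩
      · rwa [assemble_marked]
      · rwa [assemble_marked_partner]
      · rw [assemble_left]; exact (hz3 j).1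
      · rw [assemble_right]; exact (hz3 j).2
  rw [this, Measure.prod_prod, Measure.prod_prod, Measure.pi_pi, prod_labels h i]
  simp only [Measure.prod_prod]

/-- The positions of a pair excluded by a pair at positions `a`. -/
def exclusionRegion (a : ℝ × ℝ) : Set (ℝ × ℝ) :=
  Iio (min a.1 a.2) ×ˢ Iio (min a.1 a.2) ∪ Ioi (max a.1 a.2) ×ˢ Ioi (max a.1 a.2)

theorem measurableSet_exclusionRegion (a : ℝ × ℝ) : MeasurableSet (exclusionRegion a) :=
  (measurableSet_Iio.prod measurableSet_Iio).union (measurableSet_Ioi.prod measurableSet_Ioi)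

-- The marked pair never excludes itself, so the excluded pairs can be counted over `otherLeft σ i`;
-- each contributes two labels.
open Classical in
theorem card_exclusionSet_assemble :
    (exclusionSet σ i (assemble σ h i z)).card =
      2 * (Finset.univ.filter fun j : otherLeft σ i => z.2 j ∈ exclusionRegion z.1).card := by
  rw [h.card_eq_two_mul (h.map_mem_exclusionSet i _)]
  congr 1
  rw [← Finset.card_map (Function.Embedding.subtype _)]
  congr 1
  ext k
  simp only [Finset.mem_filter, Finset.mem_map, Finset.mem_univ, true_and,
    Function.Embedding.subtype_apply]
  have key : ∀ j : otherLeft σ i, (j : Fin (2 * n)) ∈ exclusionSet σ i (assemble σ h i z) ↔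
      z.2 j ∈ exclusionRegion z.1 := by
    intro j
    simp [exclusionSet, exclusionRegion, assemble_left, assemble_right, assemble_marked,
      assemble_marked_partner]
  constructor
  · rintro ⟨hk, hlt⟩
    have hne : k ≠ i ∧ k ≠ σ i := by
      constructor <;> rintro rfl <;> simp [exclusionSet] at hk
    refine ⟨⟨k, mem_otherLeft.2 ⟨hne, hlt⟩⟩, (key _).1 hk, rfl⟩
  · rintro ⟨j, hj, rfl⟩
    exact ⟨(key j).2 hj, (mem_otherLeft.1 j.2).2⟩

end assemble

theorem uniformUnit_exclusionRegion {a : ℝ × ℝ} (h1 : a.1 ∈ Icc (0 : ℝ) 1)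
    (h2 : a.2 ∈ Icc (0 : ℝ) 1) :
    (uniformUnit.prod uniformUnit) (exclusionRegion a) =
      ENNReal.ofReal (min a.1 a.2 ^ 2 + (1 - max a.1 a.2) ^ 2) := by
  have hmin : 0 ≤ min a.1 a.2 := le_min h1.1 h2.1
  have hmin1 : min a.1 a.2 ≤ 1 := (min_le_left _ _).trans h1.2
  have hmax : max a.1 a.2 ≤ 1 := max_le h1.2 h2.2
  have hmax0 : 0 ≤ max a.1 a.2 := h1.1.trans (le_max_left _ _)
  have e1 : uniformUnit (Iio (min a.1 a.2)) = ENNReal.ofReal (min a.1 a.2) := by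
    rw [uniformUnit, Measure.restrict_apply measurableSet_Iio]
    have : Iio (min a.1 a.2) ∩ Icc 0 1 = Ico 0 (min a.1 a.2) := by
      ext t; simp only [mem_inter_iff, mem_Iio, mem_Icc, mem_Ico]
      exact ⟨fun h => ⟨h.2.1, h.1⟩, fun h => ⟨h.2, h.1, h.2.le.trans hmin1⟩⟩
    rw [this, Real.volume_Ico, sub_zero]
  have e2 : uniformUnit (Ioi (max a.1 a.2)) = ENNReal.ofReal (1 - max a.1 a.2) := by
    rw [uniformUnit, Measure.restrict_apply measurableSet_Ioi]
    have : Ioi (max a.1 a.2) ∩ Icc 0 1 = Ioc (max a.1 a.2) 1 := by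
      ext t; simp only [mem_inter_iff, mem_Ioi, mem_Icc, mem_Ioc]
      exact ⟨fun h => ⟨h.1, h.2.2⟩, fun h => ⟨h.1, hmax0.trans h.1.le, h.2⟩⟩
    rw [this, Real.volume_Ioc]
  rw [exclusionRegion, measure_union _ (measurableSet_Ioi.prod measurableSet_Ioi),
    Measure.prod_prod, Measure.prod_prod, e1, e2, ENNReal.ofReal_add (by positivity)
    (by positivity), ENNReal.ofReal_pow hmin, ENNReal.ofReal_pow (by linarith), sq, sq]
  rw [Set.disjoint_left]
  rintro t ⟨ht, _⟩ ⟨ht', _⟩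
  have ht : t.1 < min a.1 a.2 := ht
  have ht' : max a.1 a.2 < t.1 := ht'
  exact absurd (ht.trans (min_le_max.trans_lt ht')) (lt_irrefl _)

theorem measurableSet_card_exclusionSet {n : ℕ} (σ : Equiv.Perm (Fin (2 * n)))
    (i : Fin (2 * n)) (q : ℕ) :
    MeasurableSet {x : Fin (2 * n) → ℝ | (exclusionSet σ i x).card = q} := by
  have : Measurable fun x : Fin (2 * n) → ℝ => (exclusionSet σ i x).card := by
    simp only [exclusionSet, Finset.card_filter]
    refine Finset.measurable_sum _ fun k _ => Measurable.ite ?_ measurable_const measurable_const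
    have hlt : ∀ a b : Fin (2 * n), MeasurableSet {x : Fin (2 * n) → ℝ | x a < x b} :=
      fun a b => measurableSet_lt (measurable_pi_apply a) (measurable_pi_apply b)
    exact (((hlt _ _).inter (hlt _ _)).inter ((hlt _ _).inter (hlt _ _))).union
      (((hlt _ _).inter (hlt _ _)).inter ((hlt _ _).inter (hlt _ _)))
  exact this (measurableSet_singleton q)

/-! ### The exact mixture of binomial laws -/

/-- The probability of `p` successes in `m` independent trials of success probability `t`. -/
def binomialMass (m p : ℕ) (t : ℝ) : ℝ := m.choose p * (t ^ p * (1 - t) ^ (m - p))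

theorem binomialMass_nonneg (m p : ℕ) {t : ℝ} (h0 : 0 ≤ t) (h1 : t ≤ 1) :
    0 ≤ binomialMass m p t :=
  mul_nonneg (Nat.cast_nonneg _) (mul_nonneg (pow_nonneg h0 _) (pow_nonneg (by linarith) _))

theorem continuous_binomialMass (m p : ℕ) : Continuous (binomialMass m p) := by
  unfold binomialMass; fun_prop

/-- By Fubini, with the marked pair fixed at `a`, the other `n - 1` pairs are independent trials
with success set `exclusionRegion a`. -/
theorem measure_card_exclusionSet {n : ℕ} {σ : Equiv.Perm (Fin (2 * n))}
    (h : IsChordDiagram σ) (i : Fin (2 * n)) (p : ℕ) :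
    Measure.pi (fun _ : Fin (2 * n) => uniformUnit) {x | (exclusionSet σ i x).card = 2 * p} =
      ∫⁻ a, ENNReal.ofReal (binomialMass (n - 1) p (min a.1 a.2 ^ 2 + (1 - max a.1 a.2) ^ 2))
        ∂(uniformUnit.prod uniformUnit) := by
  classical
  have hm := measurableSet_card_exclusionSet σ i (2 * p)
  rw [← map_assemble h i, Measure.map_apply (measurable_assemble h i) hm,
    Measure.prod_apply (measurable_assemble h i hm)]
  have hae : ∀ᵐ a ∂(uniformUnit.prod uniformUnit), a ∈ Icc (0 : ℝ) 1 ×ˢ Icc (0 : ℝ) 1 := by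
    rw [uniformUnit, Measure.prod_restrict]
    exact ae_restrict_mem (measurableSet_Icc.prod measurableSet_Icc)
  refine lintegral_congr_ae ?_
  filter_upwards [hae] with a ha
  have hset : Prod.mk a ⁻¹' (assemble σ h i ⁻¹' {x | (exclusionSet σ i x).card = 2 * p}) =
      {y | (Finset.univ.filter fun j : otherLeft σ i => y j ∈ exclusionRegion a).card = p} := by
    ext y
    simp [card_exclusionSet_assemble]
  have hp := prob_compl_eq_one_sub (μ := uniformUnit.prod uniformUnit)
    (measurableSet_exclusionRegion a)
  have hw1 := prob_le_one (μ := uniformUnit.prod uniformUnit) (s := exclusionRegion a)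
  rw [hset, pi_card_mem_eq _ (measurableSet_exclusionRegion a), hp]
  rw [uniformUnit_exclusionRegion ha.1 ha.2] at hw1 ⊢
  set w := min a.1 a.2 ^ 2 + (1 - max a.1 a.2) ^ 2 with hw
  have hw0 : 0 ≤ w := by positivity
  have hw1 : w ≤ 1 := by simpa using hw1
  rw [Fintype.card_coe, card_otherLeft h, binomialMass, ENNReal.ofReal_mul (by positivity),
    ENNReal.ofReal_mul (by positivity), ENNReal.ofReal_pow hw0,
    ENNReal.ofReal_pow (by linarith), ENNReal.ofReal_sub _ hw0, ENNReal.ofReal_one,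
    ENNReal.ofReal_natCast]

/-- Substitution `t = r ^ 2`: the factor 2 from the two triangles turns `r dr` into `dt`. Radii
beyond 1 contribute nothing, the density being nonpositive there. -/
theorem lintegral_binomialMass (m p : ℕ) :
    ∫⁻ a, ENNReal.ofReal (binomialMass m p (min a.1 a.2 ^ 2 + (1 - max a.1 a.2) ^ 2))
        ∂(uniformUnit.prod uniformUnit) =
      ENNReal.ofReal (∫ t in (0 : ℝ)..1, binomialMass m p t * excludedDensity t) := by
  have hc := (continuous_binomialMass m p).mul continuous_excludedDensity
  rw [uniformUnit, lintegral_unitSquare_spread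
    (H := fun t => ENNReal.ofReal (binomialMass m p t))
    (continuous_binomialMass m p).measurable.ennreal_ofReal]
  have h1 : ∫⁻ r in Ioi (0 : ℝ), ENNReal.ofReal r * ENNReal.ofReal (binomialMass m p (r ^ 2)) *
        ENNReal.ofReal (excludedDensity (r ^ 2)) =
      ∫⁻ r in Ioc (0 : ℝ) 1,
        ENNReal.ofReal (r * (binomialMass m p (r ^ 2) * excludedDensity (r ^ 2))) := by
    rw [← Ioc_union_Ioi_eq_Ioi (zero_le_one (α := ℝ)), lintegral_union measurableSet_Ioi
      (Ioc_disjoint_Ioi le_rfl)]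
    have : ∫⁻ r in Ioi (1 : ℝ), ENNReal.ofReal r * ENNReal.ofReal (binomialMass m p (r ^ 2)) *
        ENNReal.ofReal (excludedDensity (r ^ 2)) = 0 := by
      rw [setLIntegral_congr_fun (g := fun _ => 0) measurableSet_Ioi, lintegral_zero]
      intro r hr
      have hr : 1 < r := hr
      simp [ENNReal.ofReal_of_nonpos (excludedDensity_nonpos (by nlinarith : 1 ≤ r ^ 2))]
    rw [this, add_zero]
    refine setLIntegral_congr_fun measurableSet_Ioc fun r hr => ?_
    have hr2 : r ^ 2 ≤ 1 := by nlinarith [hr.1, hr.2]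
    rw [ENNReal.ofReal_mul hr.1.le,
      ENNReal.ofReal_mul (binomialMass_nonneg m p (sq_nonneg r) hr2), mul_assoc]
  have hc2 : Continuous fun r : ℝ =>
      r * (binomialMass m p (r ^ 2) * excludedDensity (r ^ 2)) :=
    continuous_id.mul (hc.comp (continuous_pow 2))
  rw [h1, ← ofReal_integral_eq_lintegral_ofReal, ← intervalIntegral.integral_of_le zero_le_one]
  · have h2 := intervalIntegral.integral_comp_mul_deriv (a := 0) (b := 1)
      (f := fun r : ℝ => r ^ 2) (f' := fun r => 2 * r)
      (g := fun t => binomialMass m p t * excludedDensity t)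
      (fun r _ => by simpa using hasDerivAt_pow 2 r) (by fun_prop) hc
    norm_num at h2
    rw [← h2, show (2 : ENNReal) = ENNReal.ofReal 2 by simp, ← ENNReal.ofReal_mul (by norm_num),
      ← intervalIntegral.integral_const_mul]
    congr 2
    ext r; ring
  · exact (hc2.integrableOn_Icc (a := 0) (b := 1)).mono_set Ioc_subset_Icc_self
  · refine (ae_restrict_iff' measurableSet_Ioc).2 (Filter.Eventually.of_forall fun r hr => ?_)
    have hr2 : r ^ 2 ≤ 1 := by nlinarith [hr.1, hr.2]
    exact mul_nonneg hr.1.le (mul_nonneg (binomialMass_nonneg m p (sq_nonneg r) hr2)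
      (excludedDensity_nonneg hr2))

/-- The number of excluded pairs is a mixture of binomial distributions, with mixing density
`excludedDensity`. -/
theorem excludedProb_eq_integral {n : ℕ} (hn : 1 ≤ n) (p : ℕ) :
    excludedProb n p = ∫ t in (0 : ℝ)..1, binomialMass (n - 1) p t * excludedDensity t := by
  have hnn : 0 ≤ ∫ t in (0 : ℝ)..1, binomialMass (n - 1) p t * excludedDensity t :=
    intervalIntegral.integral_nonneg zero_le_one fun t ht =>
      mul_nonneg (binomialMass_nonneg _ _ ht.1 ht.2) (excludedDensity_nonneg ht.2)
  refine excludedProb_eq_of_card_perm hn fun σ i h => ?_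
  have h1 := card_perm_eq_factorial_mul (N := 2 * n)
    (P := fun x => (exclusionSet σ i x).card = 2 * p)
    (Q := fun g => (exclusionSet σ i g).card = 2 * p) (by
      intro g x hx
      -- The exclusion set depends only on comparisons between positions, which are constant on a
      -- cell.
      have : exclusionSet σ i x = exclusionSet σ i g := by
        ext k; simp [exclusionSet, hx _ _]
      rw [this])
  rw [measure_card_exclusionSet h, lintegral_binomialMass] at h1
  have h2 := congrArg ENNReal.toReal h1
  rwa [ENNReal.toReal_natCast, ENNReal.toReal_mul, ENNReal.toReal_natCast,
    ENNReal.toReal_ofReal hnn] at h2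

/-! ### Beta integrals and the local limit -/

theorem integral_pow_mul_one_sub_pow (p q : ℕ) :
    ∫ t in (0 : ℝ)..1, t ^ p * (1 - t) ^ q =
      (p.factorial * q.factorial : ℝ) / (p + q + 1).factorial := by
  induction q generalizing p with
  | zero =>
    simp only [pow_zero, mul_one, integral_pow, Nat.factorial_zero, Nat.cast_one, add_zero]
    rw [Nat.factorial_succ]
    have : (p.factorial : ℝ) ≠ 0 := by positivity
    push_cast
    field_simp
    simp
  | succ q ih =>
    -- Integration by parts: this function vanishes at both endpoints, which trades a factor `1 - t`
    -- for a factor `t`.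
    have hd : ∀ t ∈ uIcc (0 : ℝ) 1, HasDerivAt (fun t : ℝ => t ^ (p + 1) * (1 - t) ^ (q + 1))
        ((p + 1) * (t ^ p * (1 - t) ^ (q + 1)) - (q + 1) * (t ^ (p + 1) * (1 - t) ^ q)) t := by
      intro t _
      have h1 := hasDerivAt_pow (p + 1) t
      have h2 := ((hasDerivAt_id t).const_sub 1).pow (q + 1)
      convert! h1.mul h2 using 1
      push_cast
      simp only [id, Pi.pow_apply]
      ring
    have h := intervalIntegral.integral_eq_sub_of_hasDerivAt hd
      (Continuous.intervalIntegrable (by fun_prop) _ _)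
    rw [intervalIntegral.integral_sub (Continuous.intervalIntegrable (by fun_prop) _ _)
      (Continuous.intervalIntegrable (by fun_prop) _ _), intervalIntegral.integral_const_mul,
      intervalIntegral.integral_const_mul, ih (p + 1)] at h
    simp only [one_pow, sub_self, ne_eq, Nat.add_eq_zero_iff, one_ne_zero, and_false,
      not_false_eq_true, zero_pow, mul_zero, zero_mul] at h
    have hp : (p + 1 : ℝ) ≠ 0 := by positivity
    apply mul_left_cancel₀ hp
    rw [sub_eq_zero.1 h, Nat.factorial_succ p, Nat.factorial_succ q,
      show p + 1 + q + 1 = p + (q + 1) + 1 by ring]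
    push_cast
    ring

theorem integral_binomialMass {m p : ℕ} (hp : p ≤ m) :
    ∫ t in (0 : ℝ)..1, binomialMass m p t = 1 / (m + 1) := by
  unfold binomialMass
  rw [intervalIntegral.integral_const_mul, integral_pow_mul_one_sub_pow,
    show p + (m - p) + 1 = m + 1 by omega, Nat.factorial_succ,
    ← Nat.choose_mul_factorial_mul_factorial hp]
  have h1 : (m.choose p : ℝ) ≠ 0 := by exact_mod_cast (Nat.choose_pos hp).ne'
  have h2 : (p.factorial : ℝ) ≠ 0 := by positivity
  have h3 : ((m - p).factorial : ℝ) ≠ 0 := by positivity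
  push_cast
  field_simp

/-- Multiplication by `t` shifts the beta parameters, so moments reduce to `integral_binomialMass`.
-/
theorem mul_binomialMass (m p : ℕ) (t : ℝ) :
    t * binomialMass m p t = (p + 1) / (m + 1) * binomialMass (m + 1) (p + 1) t := by
  have h : ((m + 1 : ℕ) : ℝ) * m.choose p = (m + 1).choose (p + 1) * (p + 1 : ℕ) := by
    exact_mod_cast Nat.add_one_mul_choose_eq m p
  push_cast at h
  unfold binomialMass
  rw [Nat.add_sub_add_right]
  field_simp
  linear_combination (t ^ (p + 1) * (1 - t) ^ (m - p)) * h

theorem integral_binomialMass_mul_sq {m p : ℕ} (hp : p ≤ m) (x : ℝ) :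
    (m + 1) * ∫ t in (0 : ℝ)..1, binomialMass m p t * (t - x) ^ 2 =
      (p + 1) / (m + 2) * ((p + 2) / (m + 3)) - 2 * x * ((p + 1) / (m + 2)) + x ^ 2 := by
  have e : ∀ t : ℝ, binomialMass m p t * (t - x) ^ 2 =
      (p + 1) / (m + 1) * ((p + 2) / (m + 2)) * binomialMass (m + 2) (p + 2) t -
        2 * x * ((p + 1) / (m + 1)) * binomialMass (m + 1) (p + 1) t +
        x ^ 2 * binomialMass m p t := by
    intro t
    have h1 := mul_binomialMass m p t
    have h2 := mul_binomialMass (m + 1) (p + 1) t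
    push_cast at h2
    rw [show (p : ℝ) + 1 + 1 = p + 2 by ring, show (m : ℝ) + 1 + 1 = m + 2 by ring] at h2
    linear_combination (t - 2 * x) * h1 + (p + 1) / (m + 1) * h2
  have hi : ∀ a b : ℕ, IntervalIntegrable (binomialMass a b) volume 0 1 :=
    fun a b => (continuous_binomialMass a b).intervalIntegrable _ _
  simp only [e]
  rw [intervalIntegral.integral_add (((hi _ _).const_mul _).sub ((hi _ _).const_mul _))
    ((hi _ _).const_mul _), intervalIntegral.integral_sub ((hi _ _).const_mul _)
    ((hi _ _).const_mul _), intervalIntegral.integral_const_mul,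
    intervalIntegral.integral_const_mul, intervalIntegral.integral_const_mul,
    integral_binomialMass hp, integral_binomialMass (by omega), integral_binomialMass (by omega)]
  push_cast
  field_simp
  ring

theorem tendsto_integral_binomialMass_sq {p : ℕ → ℕ} (hp : ∀ m, p m ≤ m) {x : ℝ}
    (hx : Tendsto (fun m : ℕ => (p m : ℝ) / m) atTop (𝓝 x)) :
    Tendsto (fun m : ℕ => ((m : ℝ) + 1) * ∫ t in (0 : ℝ)..1, binomialMass m (p m) t * (t - x) ^ 2)
      atTop (𝓝 0) := by
  have key : ∀ a b : ℝ, Tendsto (fun m : ℕ => ((p m : ℝ) + a) / (m + b)) atTop (𝓝 x) := by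
    intro a b
    have hinv : Tendsto (fun m : ℕ => ((m : ℝ))⁻¹) atTop (𝓝 0) :=
      tendsto_inv_atTop_zero.comp tendsto_natCast_atTop_atTop
    have h := (hx.add (hinv.const_mul a)).div ((hinv.const_mul b).const_add 1) (by simp)
    simp only [mul_zero, add_zero, div_one] at h
    refine h.congr' ?_
    filter_upwards [eventually_gt_atTop 0] with m hm
    have hm' : (m : ℝ) ≠ 0 := by positivity
    simp only [Pi.div_apply]
    rw [← mul_div_mul_right ((p m : ℝ) / m + a * (m : ℝ)⁻¹) (1 + b * (m : ℝ)⁻¹) hm']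
    congr 1 <;> field_simp
  simp only [integral_binomialMass_mul_sq (hp _)]
  have h := (((key 1 2).mul (key 2 3)).sub ((key 1 2).const_mul (2 * x))).add_const (x ^ 2)
  rwa [show x * x - 2 * x * x + x ^ 2 = 0 by ring] at h

/-- The beta distributions with densities `(m + 1) * binomialMass m (p m)` concentrate at the limit
of `p m / m`. -/
theorem tendsto_integral_binomialMass_mul {p : ℕ → ℕ} (hp : ∀ m, p m ≤ m) {x : ℝ}
    (hx : Tendsto (fun m : ℕ => (p m : ℝ) / m) atTop (𝓝 x)) {f : ℝ → ℝ} (hf : Continuous f) :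
    Tendsto (fun m : ℕ => ((m : ℝ) + 1) * ∫ t in (0 : ℝ)..1, binomialMass m (p m) t * f t)
      atTop (𝓝 (f x)) := by
  obtain ⟨M, hM⟩ := isCompact_Icc.exists_bound_of_continuousOn (s := Icc (0 : ℝ) 1)
    (f := fun t => f t - f x) (by fun_prop)
  have hM0 : 0 ≤ M := (norm_nonneg _).trans (hM 0 (by simp))
  rw [Metric.tendsto_atTop']
  intro ε hε
  obtain ⟨δ, hδ, hfδ⟩ := Metric.continuousAt_iff.1 hf.continuousAt (ε / 2) (by positivity)
  have hC : 0 ≤ M / δ ^ 2 := by positivity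
  -- Continuity controls `t` within `δ` of `x`; elsewhere `(t - x) ^ 2 / δ ^ 2 ≥ 1` absorbs the
  -- bound `M`, so the second moment about `x` suffices.
  have hbound : ∀ t ∈ Icc (0 : ℝ) 1, |f t - f x| ≤ ε / 2 + M / δ ^ 2 * (t - x) ^ 2 := by
    intro t ht
    by_cases h : dist t x < δ
    · have h1 := (hfδ h).le
      rw [Real.dist_eq] at h1
      have := mul_nonneg hC (sq_nonneg (t - x))
      linarith
    · have h1 : |f t - f x| ≤ M := hM t ht
      have h2 : δ ^ 2 ≤ (t - x) ^ 2 := by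
        rw [← sq_abs (t - x)]
        exact pow_le_pow_left₀ hδ.le (by rw [← Real.dist_eq]; exact not_lt.1 h) 2
      have h3 : M ≤ M / δ ^ 2 * (t - x) ^ 2 := by
        rw [div_mul_eq_mul_div, le_div_iff₀ (by positivity)]
        exact mul_le_mul_of_nonneg_left h2 hM0
      linarith
  have hV := (tendsto_integral_binomialMass_sq hp hx).const_mul (M / δ ^ 2)
  rw [mul_zero] at hV
  obtain ⟨N, hN⟩ := eventually_atTop.1 (hV.eventually_lt_const (half_pos hε))
  refine ⟨N, fun m hm => ?_⟩
  have hcb := continuous_binomialMass m (p m)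
  have hm1 : (0 : ℝ) < m + 1 := by positivity
  have e1 : ((m : ℝ) + 1) * (∫ t in (0 : ℝ)..1, binomialMass m (p m) t * f t) - f x =
      (m + 1) * ∫ t in (0 : ℝ)..1, binomialMass m (p m) t * (f t - f x) := by
    simp only [mul_sub]
    rw [intervalIntegral.integral_sub (Continuous.intervalIntegrable (by fun_prop) _ _)
      (Continuous.intervalIntegrable (by fun_prop) _ _), intervalIntegral.integral_mul_const,
      integral_binomialMass (hp m)]
    field_simp
  have e2 : |∫ t in (0 : ℝ)..1, binomialMass m (p m) t * (f t - f x)| ≤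
      ∫ t in (0 : ℝ)..1, (ε / 2 * binomialMass m (p m) t +
        M / δ ^ 2 * (binomialMass m (p m) t * (t - x) ^ 2)) := by
    refine (intervalIntegral.abs_integral_le_integral_abs zero_le_one).trans ?_
    refine intervalIntegral.integral_mono_on zero_le_one
      (Continuous.intervalIntegrable (by fun_prop) _ _)
      (Continuous.intervalIntegrable (by fun_prop) _ _) fun t ht => ?_
    have hb := binomialMass_nonneg m (p m) ht.1 ht.2
    rw [abs_mul, abs_of_nonneg hb]
    calc _ ≤ binomialMass m (p m) t * (ε / 2 + M / δ ^ 2 * (t - x) ^ 2) :=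
          mul_le_mul_of_nonneg_left (hbound t ht) hb
      _ = _ := by ring
  rw [intervalIntegral.integral_add (Continuous.intervalIntegrable (by fun_prop) _ _)
    (Continuous.intervalIntegrable (by fun_prop) _ _), intervalIntegral.integral_const_mul,
    intervalIntegral.integral_const_mul, integral_binomialMass (hp m)] at e2
  rw [Real.dist_eq, e1, abs_mul, abs_of_pos hm1]
  refine (mul_le_mul_of_nonneg_left e2 hm1.le).trans_lt ?_
  have h3 := hN m hm.le
  rw [mul_add]
  have h4 : ((m : ℝ) + 1) * (ε / 2 * (1 / (m + 1))) = ε / 2 := by field_simp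
  rw [h4]
  linarith [mul_left_comm ((m : ℝ) + 1) (M / δ ^ 2)
    (∫ t in (0 : ℝ)..1, binomialMass m (p m) t * (t - x) ^ 2)]

theorem binomialMass_eq_zero {m p : ℕ} (h : m < p) (t : ℝ) : binomialMass m p t = 0 := by
  simp [binomialMass, Nat.choose_eq_zero_of_lt h]

/-- Truncating `p m` at `m` makes the beta limit applicable. The truncation matters in the limit
only for `x = 1`: there `p m > m` may recur, but the probability is then 0 and so is the limiting
density. -/
theorem tendsto_mul_excludedProb {x : ℝ} (hx1 : x ≤ 1) {p : ℕ → ℕ}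
    (hx : Tendsto (fun m : ℕ => (p m : ℝ) / m) atTop (𝓝 x)) :
    Tendsto (fun m : ℕ => (m : ℝ) * excludedProb (m + 1) (p m)) atTop
      (𝓝 (excludedDensity x)) := by
  have hq : ∀ m, min (p m) m ≤ m := fun m => min_le_right _ _
  have hqx : Tendsto (fun m : ℕ => ((min (p m) m : ℕ) : ℝ) / m) atTop (𝓝 x) := by
    have h := hx.min (tendsto_const_nhds (x := (1 : ℝ)))
    rw [min_eq_left hx1] at h
    refine h.congr' ?_
    filter_upwards [eventually_gt_atTop 0] with m hm
    have hm' : (0 : ℝ) < m := by positivity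
    rw [Nat.cast_min, ← min_div_div_right hm'.le, div_self hm'.ne']
  have hK := tendsto_integral_binomialMass_mul hq hqx continuous_excludedDensity
  have hr : Tendsto (fun m : ℕ => (m : ℝ) / (m + 1)) atTop (𝓝 1) :=
    tendsto_natCast_div_add_atTop 1
  have hK2 : Tendsto (fun m : ℕ => (m : ℝ) * ∫ t in (0 : ℝ)..1,
      binomialMass m (min (p m) m) t * excludedDensity t) atTop (𝓝 (excludedDensity x)) := by
    have h := hr.mul hK
    rw [one_mul] at h
    refine h.congr fun m => ?_
    have : (m : ℝ) + 1 ≠ 0 := by positivity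
    rw [← mul_assoc, div_mul_cancel₀ _ this]
  have hle : ∀ m, p m ≤ m → (m : ℝ) * excludedProb (m + 1) (p m) =
      m * ∫ t in (0 : ℝ)..1, binomialMass m (min (p m) m) t * excludedDensity t := by
    intro m hm
    rw [excludedProb_eq_integral (by omega), min_eq_left hm, Nat.add_sub_cancel]
  have hgt : ∀ m, m < p m → (m : ℝ) * excludedProb (m + 1) (p m) = 0 := by
    intro m hm
    rw [excludedProb_eq_integral (by omega), Nat.add_sub_cancel]
    simp [binomialMass_eq_zero hm]
  rcases hx1.lt_or_eq with h1 | rfl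
  · refine hK2.congr' ?_
    filter_upwards [hx.eventually_lt_const h1, eventually_gt_atTop 0] with m hm hm0
    have hm' : (0 : ℝ) < m := by positivity
    rw [div_lt_one hm'] at hm
    exact (hle m (by exact_mod_cast hm.le)).symm
  · have h0 : excludedDensity 1 = 0 :=
      le_antisymm (excludedDensity_nonpos le_rfl) (excludedDensity_nonneg le_rfl)
    rw [h0] at hK2 ⊢
    have hnn : ∀ m : ℕ, 0 ≤ (m : ℝ) * ∫ t in (0 : ℝ)..1,
        binomialMass m (min (p m) m) t * excludedDensity t := fun m =>
      mul_nonneg (Nat.cast_nonneg _) (intervalIntegral.integral_nonneg zero_le_one fun t ht =>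
        mul_nonneg (binomialMass_nonneg _ _ ht.1 ht.2) (excludedDensity_nonneg ht.2))
    refine squeeze_zero (fun m => ?_) (fun m => ?_) hK2
    · rcases le_or_gt (p m) m with h | h
      · rw [hle m h]; exact hnn m
      · rw [hgt m h]
    · rcases le_or_gt (p m) m with h | h
      · rw [hle m h]
      · rw [hgt m h]; exact hnn m

/-! ### Binomial concentration and the distribution functions -/

theorem sum_binomialMass (m : ℕ) (t : ℝ) :
    ∑ p ∈ Finset.range (m + 1), binomialMass m p t = 1 := by
  have h := (add_pow t (1 - t) m).symm
  rw [add_sub_cancel, one_pow] at h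
  rw [← h]
  refine Finset.sum_congr rfl fun p _ => ?_
  rw [binomialMass]; ring

theorem sum_sq_mul_binomialMass (m : ℕ) (t : ℝ) :
    ∑ p ∈ Finset.range (m + 1), (m * t - p) ^ 2 * binomialMass m p t = m * t * (1 - t) := by
  have h := congrArg (Polynomial.eval t) (bernsteinPolynomial.variance ℝ m)
  simpa [Polynomial.eval_finsetSum, bernsteinPolynomial, binomialMass, mul_assoc] using h

/-- Chebyshev's inequality for the binomial distribution. -/
theorem sum_binomialMass_le {m : ℕ} (hm : 0 < m) {t : ℝ} (h0 : 0 ≤ t) (h1 : t ≤ 1) {δ : ℝ}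
    (hδ : 0 < δ) {F : Finset ℕ} (hF : F ⊆ Finset.range (m + 1))
    (hdev : ∀ p ∈ F, m * δ ≤ |m * t - p|) :
    ∑ p ∈ F, binomialMass m p t ≤ 1 / δ ^ 2 * (m : ℝ)⁻¹ := by
  have hm' : (0 : ℝ) < m := by positivity
  have hnn : ∀ p, 0 ≤ (m * t - p) ^ 2 * binomialMass m p t := fun p =>
    mul_nonneg (sq_nonneg _) (binomialMass_nonneg m p h0 h1)
  have h2 : (m * δ) ^ 2 * ∑ p ∈ F, binomialMass m p t ≤ m := by
    rw [Finset.mul_sum]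
    calc ∑ p ∈ F, (m * δ) ^ 2 * binomialMass m p t
        ≤ ∑ p ∈ F, (m * t - p) ^ 2 * binomialMass m p t := by
          refine Finset.sum_le_sum fun p hp => mul_le_mul_of_nonneg_right ?_
            (binomialMass_nonneg m p h0 h1)
          rw [← sq_abs (m * t - p)]
          exact pow_le_pow_left₀ (by positivity) (hdev p hp) 2
      _ ≤ ∑ p ∈ Finset.range (m + 1), (m * t - p) ^ 2 * binomialMass m p t :=
          Finset.sum_le_sum_of_subset_of_nonneg hF fun p _ _ => hnn p
      _ = m * t * (1 - t) := sum_sq_mul_binomialMass m t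
      _ ≤ m := by nlinarith [mul_nonneg hm'.le (sq_nonneg t), mul_nonneg hm'.le h0,
                    mul_nonneg hm'.le (sub_nonneg.2 h1)]
  have h3 : 1 / δ ^ 2 * (m : ℝ)⁻¹ = m / (m * δ) ^ 2 := by field_simp
  rw [h3, le_div_iff₀ (by positivity), mul_comm]
  exact h2

/-- The hypotheses leave open whether `F m` contains `p = m * x`, so that `≤` and `<` are both
covered. The binomial mass of `F m` tends to 1 for `t < x` and to 0 for `t > x`, and `π / 2`
dominates the integrands. -/
theorem tendsto_sum_excludedProb {x : ℝ} (hx : x ∈ Icc (0 : ℝ) 1) {F : ℕ → Finset ℕ}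
    (hF : ∀ m, F m ⊆ Finset.range (m + 1)) (hle : ∀ m, ∀ p ∈ F m, (p : ℝ) ≤ m * x)
    (hge : ∀ m, ∀ p ∈ Finset.range (m + 1) \ F m, (m : ℝ) * x ≤ p) :
    Tendsto (fun m : ℕ => ∑ p ∈ F m, excludedProb (m + 1) p) atTop
      (𝓝 (∫ t in (0 : ℝ)..x, excludedDensity t)) := by
  have hS0 : ∀ m, ∀ t ∈ Icc (0 : ℝ) 1, 0 ≤ ∑ p ∈ F m, binomialMass m p t := fun m t ht =>
    Finset.sum_nonneg fun p _ => binomialMass_nonneg m p ht.1 ht.2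
  have hS1 : ∀ m, ∀ t ∈ Icc (0 : ℝ) 1, ∑ p ∈ F m, binomialMass m p t ≤ 1 := fun m t ht => by
    rw [← sum_binomialMass m t]
    exact Finset.sum_le_sum_of_subset_of_nonneg (hF m) fun p _ _ =>
      binomialMass_nonneg m p ht.1 ht.2
  have heq : ∀ m, ∑ p ∈ F m, excludedProb (m + 1) p =
      ∫ t in (0 : ℝ)..1, (∑ p ∈ F m, binomialMass m p t) * excludedDensity t := by
    intro m
    simp only [Finset.sum_mul]
    rw [intervalIntegral.integral_finsetSum]
    · refine Finset.sum_congr rfl fun p _ => ?_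
      rw [excludedProb_eq_integral (by omega), Nat.add_sub_cancel]
    · intro p _
      exact ((continuous_binomialMass m p).mul continuous_excludedDensity).intervalIntegrable _ _
  simp only [heq]
  rw [← intervalIntegral.integral_indicator hx]
  have hinv : Tendsto (fun m : ℕ => ((m : ℝ))⁻¹) atTop (𝓝 0) :=
    tendsto_inv_atTop_zero.comp tendsto_natCast_atTop_atTop
  refine intervalIntegral.tendsto_integral_filter_of_dominated_convergence
    (fun _ => Real.pi / 2) ?_ ?_ intervalIntegrable_const ?_
  · refine Eventually.of_forall fun m => Continuous.aestronglyMeasurable ?_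
    exact (continuous_finsetSum _ fun p _ => continuous_binomialMass m p).mul
      continuous_excludedDensity
  · refine Eventually.of_forall fun m => Eventually.of_forall fun t ht => ?_
    rw [uIoc_of_le zero_le_one] at ht
    have ht' : t ∈ Icc (0 : ℝ) 1 := ⟨ht.1.le, ht.2⟩
    have hX := excludedDensity_nonneg ht.2
    rw [Real.norm_of_nonneg (mul_nonneg (hS0 m t ht') hX)]
    exact (mul_le_of_le_one_left hX (hS1 m t ht')).trans (excludedDensity_le t)
  · have hne : ∀ᵐ t : ℝ, t ≠ x := by simp [ae_iff]
    filter_upwards [hne] with t htx ht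
    rw [uIoc_of_le zero_le_one] at ht
    have ht' : t ∈ Icc (0 : ℝ) 1 := ⟨ht.1.le, ht.2⟩
    rcases lt_or_gt_of_ne htx with h | h
    · have hlim : Tendsto (fun m : ℕ => ∑ p ∈ F m, binomialMass m p t) atTop (𝓝 1) := by
        have hl := (hinv.const_mul (1 / (x - t) ^ 2)).const_sub 1
        rw [mul_zero, sub_zero] at hl
        refine tendsto_of_tendsto_of_tendsto_of_le_of_le' hl tendsto_const_nhds ?_
          (Eventually.of_forall fun m => hS1 m t ht')
        filter_upwards [eventually_gt_atTop 0] with m hm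
        have hm' : (0 : ℝ) < m := by positivity
        have hc := sum_binomialMass_le hm ht'.1 ht'.2 (sub_pos.2 h)
          -- For `t < x` Chebyshev bounds the mass of the complement of `F m`.
          (F := Finset.range (m + 1) \ F m) Finset.sdiff_subset (by
            intro p hp
            have h1 := hge m p hp
            rw [abs_sub_comm]
            exact le_trans (by linarith) (le_abs_self _))
        have hs := Finset.sum_sdiff (f := fun p => binomialMass m p t) (hF m)
        rw [sum_binomialMass] at hs
        linarith
      have hmem : t ∈ {t | t ≤ x} := h.le
      rw [indicator_of_mem hmem]
      simpa using hlim.mul_const (excludedDensity t)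
    · have hlim : Tendsto (fun m : ℕ => ∑ p ∈ F m, binomialMass m p t) atTop (𝓝 0) := by
        have hl := hinv.const_mul (1 / (t - x) ^ 2)
        rw [mul_zero] at hl
        refine tendsto_of_tendsto_of_tendsto_of_le_of_le' tendsto_const_nhds hl
          (Eventually.of_forall fun m => hS0 m t ht') ?_
        filter_upwards [eventually_gt_atTop 0] with m hm
        refine sum_binomialMass_le hm ht'.1 ht'.2 (sub_pos.2 h) (hF m) fun p hp => ?_
        have h1 := hle m p hp
        exact le_trans (by linarith) (le_abs_self _)
      have hmem : t ∉ {t | t ≤ x} := not_le.2 h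
      rw [indicator_of_notMem hmem]
      simpa using hlim.mul_const (excludedDensity t)

theorem integral_excludedDensity_half :
    ∫ t in (0 : ℝ)..1 / 2, excludedDensity t = Real.pi / 4 := by
  have h : ∀ t ∈ uIcc (0 : ℝ) (1 / 2), excludedDensity t = Real.pi / 2 := by
    intro t ht
    rw [uIcc_of_le (by norm_num)] at ht
    rw [excludedDensity_eq, Real.sqrt_eq_zero_of_nonpos (by linarith [ht.2])]
    simp
  rw [intervalIntegral.integral_congr h, intervalIntegral.integral_const]
  simp only [smul_eq_mul]
  ring

end

/-! ### The asymptotic distribution -/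

theorem mainTheorem8 :
    -- the rescaled probabilities converge to the density, at every point of `[0, 1]`
    (∀ x ∈ Set.Icc (0 : ℝ) 1, ∀ p : ℕ → ℕ,
      Filter.Tendsto (fun n : ℕ => (p n : ℝ) / ((n : ℝ) - 1)) Filter.atTop (nhds x) →
      Filter.Tendsto (fun n : ℕ => ((n : ℝ) - 1) * excludedProb n (p n)) Filter.atTop
        (nhds (excludedDensity x))) ∧
    -- the rescaled cumulative distribution functions converge accordingly
    (∀ x ∈ Set.Icc (0 : ℝ) 1,
      Filter.Tendsto
        (fun n : ℕ => ∑ p ∈ (Finset.range n).filter (fun p : ℕ => (p : ℝ) ≤ ((n : ℝ) - 1) * x),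
          excludedProb n p)
        Filter.atTop (nhds (∫ t in (0 : ℝ)..x, excludedDensity t))) ∧
    -- the probability that fewer than half of the other pairs are excluded tends to `π / 4`
    Filter.Tendsto
      (fun n : ℕ => ∑ p ∈ (Finset.range n).filter (fun p : ℕ => (p : ℝ) < ((n : ℝ) - 1) / 2),
        excludedProb n p)
      Filter.atTop (nhds (Real.pi / 4)) := by
  refine ⟨fun x hx p hp => ?_, fun x hx => ?_, ?_⟩
  -- The shift `n = m + 1` makes `m` the number of other pairs and avoids `n = 0`.
  · rw [← Filter.tendsto_add_atTop_iff_nat 1] at hp ⊢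
    push_cast at hp ⊢
    simp only [add_sub_cancel_right] at hp ⊢
    exact tendsto_mul_excludedProb hx.2 hp
  · rw [← Filter.tendsto_add_atTop_iff_nat 1]
    refine tendsto_sum_excludedProb hx (fun m => Finset.filter_subset _ _) ?_ ?_
    · intro m p hp
      have := (Finset.mem_filter.1 hp).2
      push_cast at this
      linarith
    · intro m p hp
      rw [Finset.mem_sdiff, Finset.mem_filter] at hp
      have : ¬ ((p : ℝ) ≤ (((m + 1 : ℕ) : ℝ) - 1) * x) := fun h => hp.2 ⟨hp.1, h⟩
      push_cast at this
      linarith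
  · rw [← Filter.tendsto_add_atTop_iff_nat 1, ← integral_excludedDensity_half]
    refine tendsto_sum_excludedProb (by norm_num) (fun m => Finset.filter_subset _ _) ?_ ?_
    · intro m p hp
      have := (Finset.mem_filter.1 hp).2
      push_cast at this
      linarith
    · intro m p hp
      rw [Finset.mem_sdiff, Finset.mem_filter] at hp
      have : ¬ ((p : ℝ) < (((m + 1 : ℕ) : ℝ) - 1) / 2) := fun h => hp.2 ⟨hp.1, h⟩
      push_cast at this
      linarith
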